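/- A two-player game $G$ consists of finite non-empty query alphabets $\mathcal X_1,\mathcal X_2$, finite non-empty answer alphabets $\mathcal A_1,\mathcal A_2$, a probability distribution $T$ on $\mathcal X_1\times\mathcal X_2$ and a predicate $V:(\mathcal A_1\times\mathcal A_2)\times(\mathcal X_1\times\mathcal X_2)\to\{0,1\}$. A no-signalling correlation is a family of probability distributions $P(\cdot\,|x_1x_2)$ on $\mathcal A_1\times\mathcal A_2$ for which there are conditional probability distributions $Q_1,Q_2$ with $\sum_{a_2}P(a_1a_2|x_1x_2)=Q_1(a_1|x_1)$ and $\sum_{a_1}P(a_1a_2|x_1x_2)=Q_2(a_2|x_2)$ for all $x_1,x_2,a_1,a_2$. The no-signalling value $\omega_{\mathrm{NS}}(G)$ is the maximum over all no-signalling correlations $P$ of the winning probability $\sum T(x_1x_2)\,V(a_1a_2,x_1x_2)\,P(a_1a_2|x_1x_2)$. The game $G^n$ is the two-player game in which player $i$ receives a query in $\mathcal X_i^n$ and answers in $\mathcal A_i^n$, the $n$ pairs of queries are drawn independently from $T$, and the players win if they win all $n$ rounds; the game $G^{t/n}$ is the same except that the players win if they win at least $t$ of the $n$ rounds. Theorem.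 Let $G$ be a two-player game with $\omega_{\mathrm{NS}}(G)\le 1-\delta$ for some $0<\delta<1$. Then, for every $n\in\mathbb N$, $$\omega_{\mathrm{NS}}(G^n)\le\Bigl(1-\frac{\delta^2}{27}\Bigr)^n,$$ and for every $n\in\mathbb N$, every $0<\alpha\le\delta$ and every real $t\ge(1-\delta+\alpha)n$, $$\omega_{\mathrm{NS}}(G^{t/n})\le\exp\Bigl(-n\frac{\alpha^2}{33}\Bigr).$$ -/

import Mathlib

open scoped BigOperators

/-- A two-player game with query alphabets `X`, `Y` and answer alphabets `A`, `B`: a probability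
distribution `T` on the pairs of queries and a binary predicate `V` on answers and queries. -/
structure TwoPlayerGame (X Y A B : Type*) [Fintype X] [Fintype Y] where
  /-- the probability of the pair of queries `(x, y)` -/
  T : X → Y → ℝ
  /-- the winning predicate `V (a, b, x, y)` -/
  V : A → B → X → Y → Bool
  T_nonneg : ∀ x y, 0 ≤ T x y
  T_sum : ∑ x, ∑ y, T x y = 1

/-- `Q a z`, read as `Q (a | z)`, is a family of probability distributions on the answers `a`,
indexed by the query `z`. -/
def IsCondProb {Z A : Type*} [Fintype A] (Q : A → Z → ℝ) : Prop :=
  ∀ z, (∀ a, 0 ≤ Q a z) ∧ ∑ a, Q a z = 1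

/-- The no-signalling correlations `P a b x y = P (a, b | x, y)` of two players. For each proper
subset `I` of the set of players (namely `∅`, the first player, the second player), the marginal
of `P` on the answers of the players in `I` is a probability distribution that depends only on the
queries to the players in `I`. For `I = ∅` this says that `P` is normalized. -/
structure IsNoSignalling {X Y A B : Type*} [Fintype A] [Fintype B]
    (P : A → B → X → Y → ℝ) : Prop where
  nonneg : ∀ a b x y, 0 ≤ P a b x y
  normalized : ∀ x y, ∑ a, ∑ b, P a b x y = 1
  fst : ∃ Q : A → X → ℝ, IsCondProb Q ∧ ∀ x y a, ∑ b, P a b x y = Q a x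
  snd : ∃ Q : B → Y → ℝ, IsCondProb Q ∧ ∀ x y b, ∑ a, P a b x y = Q b y

namespace TwoPlayerGame

variable {X Y A B : Type*} [Fintype X] [Fintype Y]

/-- The winning probability when the game is played with the correlation `P`. -/
noncomputable def winProb [Fintype A] [Fintype B] (G : TwoPlayerGame X Y A B)
    (P : A → B → X → Y → ℝ) : ℝ :=
  ∑ x, ∑ y, ∑ a, ∑ b, G.T x y * (if G.V a b x y = true then 1 else 0) * P a b x y

/-- The no-signalling value: the largest winning probability of a no-signalling correlation. -/
noncomputable def nsValue [Fintype A] [Fintype B] (G : TwoPlayerGame X Y A B) : ℝ :=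
  sSup {w : ℝ | ∃ P : A → B → X → Y → ℝ, IsNoSignalling P ∧ w = G.winProb P}

theorem prod_T_sum (G : TwoPlayerGame X Y A B) (n : ℕ) :
    ∑ x : Fin n → X, ∑ y : Fin n → Y, ∏ i, G.T (x i) (y i) = 1 := by
  classical
  have h : ∀ x : Fin n → X,
      ∑ y : Fin n → Y, ∏ i, G.T (x i) (y i) = ∏ i, ∑ y, G.T (x i) y := fun x =>
    (Fintype.prod_sum (fun i y => G.T (x i) y)).symm
  simp_rw [h]
  rw [← Fintype.prod_sum (fun (_ : Fin n) x => ∑ y, G.T x y)]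
  simp [G.T_sum]

/-- The `n`-fold parallel repetition `G ^ n`: independent queries, and the players win when they
win each of the `n` rounds. -/
def rep (G : TwoPlayerGame X Y A B) (n : ℕ) :
    TwoPlayerGame (Fin n → X) (Fin n → Y) (Fin n → A) (Fin n → B) where
  T x y := ∏ i, G.T (x i) (y i)
  V a b x y := decide (∀ i, G.V (a i) (b i) (x i) (y i) = true)
  T_nonneg x y := Finset.prod_nonneg fun i _ => G.T_nonneg (x i) (y i)
  T_sum := G.prod_T_sum n

/-- The game `G ^ (t / n)`: `n` rounds with independent queries are played in parallel, and the
players win when they win at least `t` of the `n` rounds. -/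
noncomputable def threshold (G : TwoPlayerGame X Y A B) (n : ℕ) (t : ℝ) :
    TwoPlayerGame (Fin n → X) (Fin n → Y) (Fin n → A) (Fin n → B) where
  T x y := ∏ i, G.T (x i) (y i)
  V a b x y := decide
    (t ≤ ∑ i, if G.V (a i) (b i) (x i) (y i) = true then (1 : ℝ) else 0)
  T_nonneg x y := Finset.prod_nonneg fun i _ => G.T_nonneg (x i) (y i)
  T_sum := G.prod_T_sum n

end TwoPlayerGame

theorem IsNoSignalling.exists_ge {X Y A B : Type*} [Fintype A] [Fintype B]
    {R : A → B → X → Y → ℝ} {p : A → X → ℝ} {q : B → Y → ℝ} (hR : ∀ a b x y, 0 ≤ R a b x y)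
    (hp : IsCondProb p) (hq : IsCondProb q) (hRp : ∀ x y a, ∑ b, R a b x y ≤ p a x)
    (hRq : ∀ x y b, ∑ a, R a b x y ≤ q b y) :
    ∃ P : A → B → X → Y → ℝ, IsNoSignalling P ∧ ∀ a b x y, R a b x y ≤ P a b x y := by
  set s : X → Y → ℝ := fun x y => 1 - ∑ a, ∑ b, R a b x y with hs
  set u : X → Y → A → ℝ := fun x y a => p a x - ∑ b, R a b x y with hu
  set v : X → Y → B → ℝ := fun x y b => q b y - ∑ a, R a b x y with hv
  have hu0 : ∀ x y a, 0 ≤ u x y a := fun x y a => sub_nonneg.2 (hRp x y a)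
  have hv0 : ∀ x y b, 0 ≤ v x y b := fun x y b => sub_nonneg.2 (hRq x y b)
  have hus : ∀ x y, ∑ a, u x y a = s x y := fun x y => by
    simp [hu, hs, Finset.sum_sub_distrib, (hp x).2]
  have hvs : ∀ x y, ∑ b, v x y b = s x y := fun x y => by
    simp only [hv, hs, Finset.sum_sub_distrib, (hq y).2]
    rw [Finset.sum_comm]
  have hs0 : ∀ x y, 0 ≤ s x y := fun x y => hus x y ▸ Finset.sum_nonneg fun a _ => hu0 x y a
  have hus' : ∀ x y a, u x y a * s x y / s x y = u x y a := fun x y a => by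
    by_cases h : s x y = 0
    · have := (Finset.sum_eq_zero_iff_of_nonneg fun a _ => hu0 x y a).1 ((hus x y).trans h) a
        (Finset.mem_univ a)
      simp [this]
    · field_simp
  have hvs' : ∀ x y b, s x y * v x y b / s x y = v x y b := fun x y b => by
    by_cases h : s x y = 0
    · have := (Finset.sum_eq_zero_iff_of_nonneg fun b _ => hv0 x y b).1 ((hvs x y).trans h) b
        (Finset.mem_univ b)
      simp [this]
    · field_simp
  have hA : ∀ x y a, ∑ b, (R a b x y + u x y a * v x y b / s x y) = p a x := fun x y a => by
    rw [Finset.sum_add_distrib, ← Finset.sum_div, ← Finset.mul_sum, hvs, hus']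
    simp [hu]
  have hB : ∀ x y b, ∑ a, (R a b x y + u x y a * v x y b / s x y) = q b y := fun x y b => by
    rw [Finset.sum_add_distrib, ← Finset.sum_div, ← Finset.sum_mul, hus, hvs']
    simp [hv]
  have hnn : ∀ a b x y, 0 ≤ u x y a * v x y b / s x y := fun a b x y =>
    div_nonneg (mul_nonneg (hu0 x y a) (hv0 x y b)) (hs0 x y)
  refine ⟨fun a b x y => R a b x y + u x y a * v x y b / s x y,
    ⟨fun a b x y => add_nonneg (hR a b x y) (hnn a b x y), fun x y => ?_, ⟨p, hp, hA⟩,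
      ⟨q, hq, hB⟩⟩, fun a b x y => le_add_of_nonneg_right (hnn a b x y)⟩
  simp only [hA, (hp x).2]

theorem IsNoSignalling.swap {X Y A B : Type*} [Fintype A] [Fintype B] {P : A → B → X → Y → ℝ}
    (hP : IsNoSignalling P) : IsNoSignalling fun b a y x => P a b x y where
  nonneg b a y x := hP.nonneg a b x y
  normalized y x := by rw [Finset.sum_comm]; exact hP.normalized x y
  fst := let ⟨q, hq, h⟩ := hP.snd; ⟨q, hq, fun y x b => h x y b⟩
  snd := let ⟨q, hq, h⟩ := hP.fst; ⟨q, hq, fun y x b => h x y b⟩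

namespace TwoPlayerGame

variable {X Y A B : Type*} [Fintype X] [Fintype Y] [Fintype A] [Fintype B]

theorem winProb_le_one (G : TwoPlayerGame X Y A B) {P : A → B → X → Y → ℝ}
    (hP : IsNoSignalling P) : G.winProb P ≤ 1 := by
  rw [← G.T_sum]
  refine Finset.sum_le_sum fun x _ => Finset.sum_le_sum fun y _ => ?_
  calc _ ≤ ∑ a, ∑ b, G.T x y * P a b x y := ?_
    _ = G.T x y := by simp only [← Finset.mul_sum, hP.normalized, mul_one]
  refine Finset.sum_le_sum fun a _ => Finset.sum_le_sum fun b _ => ?_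
  have := mul_nonneg (G.T_nonneg x y) (hP.nonneg a b x y)
  split_ifs <;> simp [this]

theorem winProb_le_nsValue (G : TwoPlayerGame X Y A B) {P : A → B → X → Y → ℝ}
    (hP : IsNoSignalling P) : G.winProb P ≤ G.nsValue :=
  le_csSup ⟨1, by rintro _ ⟨P, hP, rfl⟩; exact G.winProb_le_one hP⟩ ⟨P, hP, rfl⟩

end TwoPlayerGame

section Marginal

variable {X Y A : Type*} [Fintype Y]

/-- The conditional distribution of the answer given the query, with respect to the measure `q`
on pairs of queries and an answer. -/
noncomputable def condAnswer [Fintype A] (q : X → Y → A → ℝ) (a : A) (x : X) : ℝ :=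
  if ∑ a, ∑ y, q x y a = 0 then (Fintype.card A : ℝ)⁻¹
  else (∑ y, q x y a) / ∑ a, ∑ y, q x y a

theorem isCondProb_condAnswer [Fintype A] [Nonempty A] {q : X → Y → A → ℝ} (hq : ∀ x y a, 0 ≤ q x y a) :
    IsCondProb (condAnswer q) := by
  intro x
  by_cases h : ∑ a, ∑ y, q x y a = 0
  · simp [condAnswer, h]
  · refine ⟨fun a => ?_, ?_⟩
    · simp only [condAnswer, h, if_false]
      exact div_nonneg (Finset.sum_nonneg fun y _ => hq x y a)
        (Finset.sum_nonneg fun a _ => Finset.sum_nonneg fun y _ => hq x y a)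
    · simp only [condAnswer, h, if_false]
      rw [← Finset.sum_div, div_self h]

theorem sum_mul_condAnswer [Fintype A] {q : X → Y → A → ℝ} (hq : ∀ x y a, 0 ≤ q x y a) (a : A) (x : X) :
    (∑ a, ∑ y, q x y a) * condAnswer q a x = ∑ y, q x y a := by
  by_cases h : ∑ a, ∑ y, q x y a = 0
  · rw [h, zero_mul]
    exact ((Finset.sum_eq_zero_iff_of_nonneg fun a _ => Finset.sum_nonneg fun y _ => hq x y a).1 h a
      (Finset.mem_univ a)).symm
  · simp only [condAnswer, h, if_false]
    field_simp

/-- The conditional distribution of the second query given the first one. -/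
noncomputable def condQuery (T : X → Y → ℝ) (x : X) (y : Y) : ℝ := T x y / ∑ y, T x y

theorem condQuery_nonneg {T : X → Y → ℝ} (hT : ∀ x y, 0 ≤ T x y) (x : X) (y : Y) :
    0 ≤ condQuery T x y :=
  div_nonneg (hT x y) (Finset.sum_nonneg fun y _ => hT x y)

theorem sum_condQuery_le {T : X → Y → ℝ} (x : X) : ∑ y, condQuery T x y ≤ 1 := by
  simp only [condQuery, ← Finset.sum_div]
  exact div_self_le_one _

theorem sum_mul_condQuery {T : X → Y → ℝ} (hT : ∀ x y, 0 ≤ T x y) (x : X) (y : Y) :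
    (∑ y, T x y) * condQuery T x y = T x y := by
  by_cases h : ∑ y, T x y = 0
  · rw [h, zero_mul]
    exact ((Finset.sum_eq_zero_iff_of_nonneg fun y _ => hT x y).1 h y (Finset.mem_univ y)).symm
  · rw [condQuery]
    field_simp

theorem sum_excess_le [Fintype X] [Fintype A] [Nonempty A] {T : X → Y → ℝ} (hT : ∀ x y, 0 ≤ T x y) {q : X → Y → A → ℝ}
    (hq : ∀ x y a, 0 ≤ q x y a) :
    ∑ x, ∑ y, ∑ a, max (q x y a - T x y * condAnswer q a x) 0 ≤
      ∑ x, ∑ y, ∑ a, max (q x y a - (∑ y', q x y' a) * condQuery T x y) 0 +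
        ∑ x, ∑ y, max (∑ a, q x y a - T x y) 0 := by
  have hc := isCondProb_condAnswer hq
  rw [← Finset.sum_add_distrib]
  refine Finset.sum_le_sum fun x _ => ?_
  set d : ℝ := max (∑ a, ∑ y, q x y a - ∑ y, T x y) 0 with hd
  have hd0 : 0 ≤ d := le_max_right _ _
  have key : ∀ y a, max (q x y a - T x y * condAnswer q a x) 0 ≤
      max (q x y a - (∑ y', q x y' a) * condQuery T x y) 0 +
        d * condQuery T x y * condAnswer q a x := by
    intro y a
    have h0 : 0 ≤ condQuery T x y * condAnswer q a x :=
      mul_nonneg (condQuery_nonneg hT x y) ((hc x).1 a)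
    refine max_le ?_ (add_nonneg (le_max_right _ _) (by rw [mul_assoc]; positivity))
    have h1 := le_max_left (q x y a - (∑ y', q x y' a) * condQuery T x y) 0
    have h2 := mul_le_mul_of_nonneg_right
      (le_max_left (∑ a, ∑ y, q x y a - ∑ y, T x y) 0) h0
    rw [← hd] at h2
    have h3 := sum_mul_condAnswer hq a x
    have h4 := sum_mul_condQuery hT x y
    rw [← h3] at h1 ⊢
    nth_rewrite 1 [← h4]
    linarith
  calc _ ≤ ∑ y, ∑ a, (max (q x y a - (∑ y', q x y' a) * condQuery T x y) 0 +
        d * condQuery T x y * condAnswer q a x) :=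
        Finset.sum_le_sum fun y _ => Finset.sum_le_sum fun a _ => key y a
    _ = ∑ y, ∑ a, max (q x y a - (∑ y', q x y' a) * condQuery T x y) 0 +
        d * ∑ y, condQuery T x y := by
      simp only [Finset.sum_add_distrib, ← Finset.mul_sum, (hc x).2, mul_one]
    _ ≤ _ := by
      gcongr
      refine (mul_le_of_le_one_right hd0 (sum_condQuery_le x)).trans ?_
      refine max_le ?_ (Finset.sum_nonneg fun y _ => le_max_right _ _)
      rw [Finset.sum_comm, ← Finset.sum_sub_distrib]
      exact Finset.sum_le_sum fun y _ => le_max_left _ _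

end Marginal

theorem exists_finset_sum_max {ι : Type*} [Fintype ι] [DecidableEq ι] (f : ι → ℝ) :
    ∃ S : Finset ι, ∑ i, max (f i) 0 = ∑ i, (if i ∈ S then 1 else 0) * f i := by
  classical
  refine ⟨Finset.univ.filter fun i => 0 < f i, Finset.sum_congr rfl fun i _ => ?_⟩
  by_cases h : 0 < f i
  · simp [h, h.le]
  · simp [h, not_lt.1 h]

/-- The factor by which a mass `s` has to be scaled in order not to exceed `t`. -/
noncomputable def truncation (t s : ℝ) : ℝ := if s ≤ t then 1 else t / s

theorem truncation_nonneg {t s : ℝ} (ht : 0 ≤ t) (hs : 0 ≤ s) : 0 ≤ truncation t s := by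
  unfold truncation; split_ifs <;> positivity

theorem truncation_le_one {t s : ℝ} (ht : 0 ≤ t) : truncation t s ≤ 1 := by
  unfold truncation
  split_ifs with h
  · exact le_rfl
  · exact div_le_one_of_le₀ (not_le.1 h).le (ht.trans (not_le.1 h).le)

theorem mul_truncation_le {t s : ℝ} (ht : 0 ≤ t) : s * truncation t s ≤ t := by
  unfold truncation
  split_ifs with h
  · simpa using h
  · have : s ≠ 0 := (ht.trans_lt (not_le.1 h)).ne'
    field_simp; exact le_rfl

theorem mul_one_sub_truncation {t s : ℝ} (ht : 0 ≤ t) :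
    s * (1 - truncation t s) = max (s - t) 0 := by
  unfold truncation
  split_ifs with h
  · simp [h]
  · have : s ≠ 0 := (ht.trans_lt (not_le.1 h)).ne'
    rw [max_eq_left (by linarith [not_le.1 h])]
    field_simp

namespace TwoPlayerGame

variable {X Y A B : Type*} [Fintype X] [Fintype Y] [Fintype A] [Fintype B]

theorem sum_win_le [Nonempty A] [Nonempty B] (G : TwoPlayerGame X Y A B) {Q : X → Y → A → B → ℝ}
    (hQ : ∀ x y a b, 0 ≤ Q x y a b) :
    ∑ x, ∑ y, ∑ a, ∑ b, (if G.V a b x y = true then 1 else 0) * Q x y a b ≤ G.nsValue +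
      ∑ x, ∑ y, ∑ a, max (∑ b, Q x y a b -
        G.T x y * condAnswer (fun x y a => ∑ b, Q x y a b) a x) 0 +
      ∑ x, ∑ y, ∑ b, max (∑ a, Q x y a b -
        G.T x y * condAnswer (fun y x b => ∑ a, Q x y a b) b y) 0 := by
  set p := condAnswer (fun x y a => ∑ b, Q x y a b) with hp'
  set q := condAnswer (fun y x b => ∑ a, Q x y a b) with hq'
  have hp : IsCondProb p := isCondProb_condAnswer fun x y a => Finset.sum_nonneg fun b _ => hQ x y a b
  have hq : IsCondProb q := isCondProb_condAnswer fun y x b => Finset.sum_nonneg fun a _ => hQ x y a b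
  have hT := G.T_nonneg
  set u : X → Y → A → ℝ := fun x y a => truncation (G.T x y * p a x) (∑ b, Q x y a b) with hu
  set v : X → Y → B → ℝ := fun x y b => truncation (G.T x y * q b y) (∑ a, Q x y a b) with hv
  have hTp : ∀ x y a, 0 ≤ G.T x y * p a x := fun x y a => mul_nonneg (hT x y) ((hp x).1 a)
  have hTq : ∀ x y b, 0 ≤ G.T x y * q b y := fun x y b => mul_nonneg (hT x y) ((hq y).1 b)
  have hu0 : ∀ x y a, 0 ≤ u x y a := fun x y a =>
    truncation_nonneg (hTp x y a) (Finset.sum_nonneg fun b _ => hQ x y a b)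
  have hv0 : ∀ x y b, 0 ≤ v x y b := fun x y b =>
    truncation_nonneg (hTq x y b) (Finset.sum_nonneg fun a _ => hQ x y a b)
  have hu1 : ∀ x y a, u x y a ≤ 1 := fun x y a => truncation_le_one (hTp x y a)
  have hv1 : ∀ x y b, v x y b ≤ 1 := fun x y b => truncation_le_one (hTq x y b)
  have hRA : ∀ x y a, ∑ b, Q x y a b * u x y a * v x y b ≤ G.T x y * p a x := fun x y a =>
    calc _ ≤ ∑ b, Q x y a b * u x y a := Finset.sum_le_sum fun b _ =>
          mul_le_of_le_one_right (mul_nonneg (hQ x y a b) (hu0 x y a)) (hv1 x y b)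
      _ ≤ _ := by rw [← Finset.sum_mul]; exact mul_truncation_le (hTp x y a)
  have hRB : ∀ x y b, ∑ a, Q x y a b * u x y a * v x y b ≤ G.T x y * q b y := fun x y b =>
    calc _ ≤ ∑ a, Q x y a b * v x y b := Finset.sum_le_sum fun a _ =>
          mul_le_mul_of_nonneg_right (mul_le_of_le_one_right (hQ x y a b) (hu1 x y a)) (hv0 x y b)
      _ ≤ _ := by rw [← Finset.sum_mul]; exact mul_truncation_le (hTq x y b)
  have hR0 : ∀ x y a b, 0 ≤ Q x y a b * u x y a * v x y b := fun x y a b =>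
    mul_nonneg (mul_nonneg (hQ x y a b) (hu0 x y a)) (hv0 x y b)
  obtain ⟨P, hP, hRP⟩ := IsNoSignalling.exists_ge
    (R := fun a b x y => Q x y a b * u x y a * v x y b / G.T x y)
    (fun a b x y => div_nonneg (hR0 x y a b) (hT x y)) hp hq
    (fun x y a => by
      rw [← Finset.sum_div]
      exact div_le_of_le_mul₀ (hT x y) ((hp x).1 a) (by rw [mul_comm]; exact hRA x y a))
    (fun x y b => by
      rw [← Finset.sum_div]
      exact div_le_of_le_mul₀ (hT x y) ((hq y).1 b) (by rw [mul_comm]; exact hRB x y b))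
  have hRT : ∀ x y a b, Q x y a b * u x y a * v x y b ≤ G.T x y * P a b x y := fun x y a b => by
    rcases (hT x y).eq_or_lt with h | h
    · have h1 := hRA x y a
      rw [← h, zero_mul] at h1 ⊢
      exact (Finset.single_le_sum (fun b _ => hR0 x y a b) (Finset.mem_univ b)).trans h1
    · exact (div_le_iff₀' h).1 (hRP a b x y)
  have key : ∀ x y a b, (if G.V a b x y = true then 1 else 0) * Q x y a b ≤
      G.T x y * (if G.V a b x y = true then 1 else 0) * P a b x y +
        Q x y a b * (1 - u x y a) + Q x y a b * (1 - v x y b) := fun x y a b => by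
    have h1 := mul_nonneg (hQ x y a b) (sub_nonneg.2 (hu1 x y a))
    have h2 := mul_nonneg (hQ x y a b) (sub_nonneg.2 (hv1 x y b))
    have h3 := hRT x y a b
    have h4 := mul_nonneg h1 (sub_nonneg.2 (hv1 x y b))
    split_ifs
    · linarith
    · linarith
  calc _ ≤ ∑ x, ∑ y, ∑ a, ∑ b, (G.T x y * (if G.V a b x y = true then 1 else 0) * P a b x y +
        Q x y a b * (1 - u x y a) + Q x y a b * (1 - v x y b)) :=
        Finset.sum_le_sum fun x _ => Finset.sum_le_sum fun y _ => Finset.sum_le_sum fun a _ =>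
          Finset.sum_le_sum fun b _ => key x y a b
    _ = G.winProb P + ∑ x, ∑ y, ∑ a, (∑ b, Q x y a b) * (1 - u x y a) +
        ∑ x, ∑ y, ∑ b, (∑ a, Q x y a b) * (1 - v x y b) := by
      simp only [Finset.sum_add_distrib, winProb, Finset.sum_mul]
      congr 1
      exact Finset.sum_congr rfl fun x _ => Finset.sum_congr rfl fun y _ => Finset.sum_comm
    _ ≤ _ := by
      have h1 : ∀ x y a, (∑ b, Q x y a b) * (1 - u x y a) =
          max (∑ b, Q x y a b - G.T x y * p a x) 0 := fun x y a =>
        mul_one_sub_truncation (hTp x y a)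
      have h2 : ∀ x y b, (∑ a, Q x y a b) * (1 - v x y b) =
          max (∑ a, Q x y a b - G.T x y * q b y) 0 := fun x y b =>
        mul_one_sub_truncation (hTq x y b)
      simp only [h1, h2]
      gcongr
      exact G.winProb_le_nsValue hP

end TwoPlayerGame

theorem sum_mul_exp_le {κ : Type*} [Fintype κ] {w f : κ → ℝ} {m l : ℝ} (hw : ∀ k, 0 ≤ w k)
    (hf : ∀ k, f k = 0 ∨ f k = 1) (hm0 : 0 ≤ m) (hm1 : m ≤ 1)
    (hm : m * ∑ k, w k = ∑ k, w k * f k) (hl0 : 0 ≤ l) (hl1 : l ≤ 1) :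
    ∑ k, w k * Real.exp (l * (f k - m)) ≤ Real.exp (l ^ 2 / 4) * ∑ k, w k := by
  have hW : 0 ≤ ∑ k, w k := Finset.sum_nonneg fun k _ => hw k
  have key : ∀ k, w k * Real.exp (l * (f k - m)) ≤
      w k + l * (w k * f k) - l * m * w k +
        l ^ 2 * ((1 - 2 * m) * (w k * f k) + m ^ 2 * w k) := by
    intro k
    have h1 : |l * (f k - m)| ≤ 1 := by
      rw [abs_mul, abs_of_nonneg hl0]
      refine mul_le_one₀ hl1 (abs_nonneg _) (abs_le.2 ?_)
      rcases hf k with h | h <;> rw [h] <;> constructor <;> linarith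
    have h2 := (abs_le.1 (Real.abs_exp_sub_one_sub_id_le h1)).2
    have h3 : f k ^ 2 = f k := by rcases hf k with h | h <;> simp [h]
    have h4 : Real.exp (l * (f k - m)) ≤
        1 + l * (f k - m) + l ^ 2 * ((1 - 2 * m) * f k + m ^ 2) := by
      have : (l * (f k - m)) ^ 2 = l ^ 2 * ((1 - 2 * m) * f k + m ^ 2) := by
        linear_combination l ^ 2 * h3
      linarith
    refine (mul_le_mul_of_nonneg_left h4 (hw k)).trans_eq (by ring)
  calc _ ≤ _ := Finset.sum_le_sum fun k _ => key k
    _ = (1 + l ^ 2 * (m - m ^ 2)) * ∑ k, w k := by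
      simp only [Finset.sum_add_distrib, Finset.sum_sub_distrib, ← Finset.mul_sum, ← hm]
      ring
    _ ≤ _ := by
      gcongr
      have h1 := Real.add_one_le_exp (l ^ 2 / 4)
      nlinarith [mul_nonneg (sq_nonneg l) (sq_nonneg (m - 1 / 2))]

section Deviation

open Classical in
/-- The indicator function of a finite set, with real values. -/
noncomputable def finsetInd {κ : Type*} (S : Finset κ) (k : κ) : ℝ := if k ∈ S then 1 else 0

theorem finsetInd_eq {κ : Type*} (S : Finset κ) (k : κ) : finsetInd S k = 0 ∨ finsetInd S k = 1 := by
  unfold finsetInd; split_ifs <;> simp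

theorem finsetInd_nonneg {κ : Type*} (S : Finset κ) (k : κ) : 0 ≤ finsetInd S k := by
  rcases finsetInd_eq S k with h | h <;> simp [h]

theorem finsetInd_le_one {κ : Type*} (S : Finset κ) (k : κ) : finsetInd S k ≤ 1 := by
  rcases finsetInd_eq S k with h | h <;> simp [h]

variable {X Y A : Type*} [Fintype Y]

/-- The deviation of the indicator of `S` from its conditional expectation given the first query
and the answer, when the second query is independent of the answer given the first query. -/
noncomputable def condDev (T : X → Y → ℝ) (S : Finset (X × Y × A)) (x : X) (y : Y) (a : A) : ℝ :=
  finsetInd S (x, y, a) - ∑ y', condQuery T x y' * finsetInd S (x, y', a)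

theorem sum_mul_exp_condDev_le {T : X → Y → ℝ} (hT : ∀ x y, 0 ≤ T x y) (S : Finset (X × Y × A))
    {l : ℝ} (hl0 : 0 ≤ l) (hl1 : l ≤ 1) (x : X) (a : A) :
    ∑ y, T x y * Real.exp (l * condDev T S x y a) ≤ Real.exp (l ^ 2 / 4) * ∑ y, T x y := by
  refine sum_mul_exp_le (hT x) (fun y => finsetInd_eq S _) ?_ ?_ ?_ hl0 hl1
  · exact Finset.sum_nonneg fun y _ => mul_nonneg (condQuery_nonneg hT x y) (finsetInd_nonneg S _)
  · refine le_trans (Finset.sum_le_sum fun y _ => ?_) (sum_condQuery_le (T := T) x)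
    exact mul_le_of_le_one_right (condQuery_nonneg hT x y) (finsetInd_le_one S _)
  · rw [mul_comm, Finset.mul_sum]
    exact Finset.sum_congr rfl fun y _ => by rw [← mul_assoc, sum_mul_condQuery hT]

theorem exists_condDev [Fintype X] [Fintype A] (T : X → Y → ℝ) (q : X → Y → A → ℝ) :
    ∃ S : Finset (X × Y × A),
      ∑ x, ∑ y, ∑ a, max (q x y a - (∑ y', q x y' a) * condQuery T x y) 0 =
        ∑ x, ∑ y, ∑ a, condDev T S x y a * q x y a := by
  classical
  obtain ⟨S, hS⟩ := exists_finset_sum_max fun z : X × Y × A =>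
    q z.1 z.2.1 z.2.2 - (∑ y', q z.1 y' z.2.2) * condQuery T z.1 z.2.1
  refine ⟨S, ?_⟩
  simp only [Fintype.sum_prod_type] at hS
  rw [hS]
  refine Finset.sum_congr rfl fun x _ => ?_
  rw [Finset.sum_comm]
  conv_rhs => rw [Finset.sum_comm]
  refine Finset.sum_congr rfl fun a _ => ?_
  have h : ∀ y, (if (x, y, a) ∈ S then (1 : ℝ) else 0) = finsetInd S (x, y, a) := fun y => by
    simp [finsetInd]
  simp only [h, condDev, mul_sub, sub_mul, Finset.sum_sub_distrib]
  congr 1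
  rw [← Finset.mul_sum, mul_comm (∑ y', condQuery T x y' * _), Finset.mul_sum]
  exact Finset.sum_congr rfl fun y _ => by ring

theorem sum_prod_mul_exp_le [Fintype X] [Fintype A] {ι : Type*} [Fintype ι] [DecidableEq ι] {T : X → Y → ℝ}
    (hT : ∀ x y, 0 ≤ T x y) (hT1 : ∑ x, ∑ y, T x y = 1) {p : (ι → A) → (ι → X) → ℝ}
    (hp : IsCondProb p) {h : X → Y → A → ℝ} {C : ℝ}
    (hC : ∀ x a, ∑ y, T x y * Real.exp (h x y a) ≤ C * ∑ y, T x y) :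
    ∑ x : ι → X, ∑ y : ι → Y, ∑ a : ι → A, (∏ i, T (x i) (y i)) * p a x *
      Real.exp (∑ i, h (x i) (y i) (a i)) ≤ C ^ Fintype.card ι := by
  have h1 : ∀ x : ι → X, ∑ y : ι → Y, ∑ a : ι → A, (∏ i, T (x i) (y i)) * p a x *
      Real.exp (∑ i, h (x i) (y i) (a i)) ≤
        C ^ Fintype.card ι * ∏ i, ∑ y, T (x i) y := by
    intro x
    rw [Finset.sum_comm]
    calc _ = ∑ a : ι → A, p a x * ∏ i, ∑ y, T (x i) y * Real.exp (h (x i) y (a i)) := by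
          refine Finset.sum_congr rfl fun a _ => ?_
          rw [Fintype.prod_sum, Finset.mul_sum]
          refine Finset.sum_congr rfl fun y _ => ?_
          rw [Finset.prod_mul_distrib, Real.exp_sum]
          ring
      _ ≤ ∑ a : ι → A, p a x * ∏ i, (C * ∑ y, T (x i) y) := by
          refine Finset.sum_le_sum fun a _ => mul_le_mul_of_nonneg_left ?_ ((hp x).1 a)
          exact Finset.prod_le_prod (fun i _ => Finset.sum_nonneg fun y _ =>
            mul_nonneg (hT _ _) (Real.exp_pos _).le) fun i _ => hC _ _
      _ = _ := by
          rw [← Finset.sum_mul, (hp x).2, one_mul, Finset.prod_mul_distrib, Finset.prod_const,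
            Finset.card_univ]
  refine (Finset.sum_le_sum fun x _ => h1 x).trans_eq ?_
  rw [← Finset.mul_sum, ← Fintype.prod_sum (fun (_ : ι) x => ∑ y, T x y)]
  simp [hT1]

end Deviation

/-- The empirical distribution of a finite sequence of quadruples. -/
noncomputable def empirical {ι X Y A B : Type*} [Fintype ι] [DecidableEq X] [DecidableEq Y]
    [DecidableEq A] [DecidableEq B] (xs : ι → X) (ys : ι → Y) (as : ι → A) (bs : ι → B)
    (x : X) (y : Y) (a : A) (b : B) : ℝ :=
  (∑ i, if x = xs i then if y = ys i then if a = as i then if b = bs i then (1 : ℝ) else 0 else 0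
    else 0 else 0) / Fintype.card ι

section Empirical

variable {ι X Y A B : Type*} [Fintype ι] [DecidableEq X] [DecidableEq Y]
    [DecidableEq A] [DecidableEq B] (xs : ι → X) (ys : ι → Y) (as : ι → A) (bs : ι → B)

theorem empirical_nonneg (x : X) (y : Y) (a : A) (b : B) : 0 ≤ empirical xs ys as bs x y a b := by
  refine div_nonneg (Finset.sum_nonneg fun i _ => ?_) (Nat.cast_nonneg _)
  split_ifs <;> simp

theorem sum_mul_empirical [Fintype X] [Fintype Y] [Fintype A] [Fintype B]
    (F : X → Y → A → B → ℝ) :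
    ∑ x, ∑ y, ∑ a, ∑ b, F x y a b * empirical xs ys as bs x y a b =
      (∑ i, F (xs i) (ys i) (as i) (bs i)) / Fintype.card ι := by
  simp only [empirical, mul_div_assoc', ← Finset.sum_div, Finset.mul_sum]
  congr 1
  simp_rw [Finset.sum_comm (t := (Finset.univ : Finset ι))]
  refine Finset.sum_congr rfl fun i _ => ?_
  rw [Finset.sum_eq_single (xs i), Finset.sum_eq_single (ys i), Finset.sum_eq_single (as i),
    Finset.sum_eq_single (bs i)] <;> simp +contextual

end Empirical

namespace TwoPlayerGame

variable {X Y A B ι : Type*} [Fintype X] [Fintype Y] [Fintype ι]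

/-- The deviation of the indicator of a set of pairs of queries from its expectation. -/
noncomputable def queryDev (G : TwoPlayerGame X Y A B) (S : Finset (X × Y)) (x : X) (y : Y) : ℝ :=
  finsetInd S (x, y) - ∑ x', ∑ y', G.T x' y' * finsetInd S (x', y')

theorem exists_queryDev (G : TwoPlayerGame X Y A B) {r : X → Y → ℝ} (hr : ∑ x, ∑ y, r x y = 1) :
    ∃ S : Finset (X × Y),
      ∑ x, ∑ y, max (r x y - G.T x y) 0 = ∑ x, ∑ y, G.queryDev S x y * r x y := by
  classical
  obtain ⟨S, hS⟩ := exists_finset_sum_max fun z : X × Y => r z.1 z.2 - G.T z.1 z.2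
  refine ⟨S, ?_⟩
  simp only [Fintype.sum_prod_type] at hS
  have h : ∀ x y, (if (x, y) ∈ S then (1 : ℝ) else 0) = finsetInd S (x, y) := fun x y => by
    simp [finsetInd]
  rw [hS]
  simp only [h, queryDev, mul_sub, sub_mul, Finset.sum_sub_distrib]
  congr 1
  simp only [← Finset.mul_sum, hr, mul_one]
  simp only [mul_comm]

theorem sum_prod_mul_exp_queryDev_le [DecidableEq ι] (G : TwoPlayerGame X Y A B) (S : Finset (X × Y)) {l : ℝ}
    (hl0 : 0 ≤ l) (hl1 : l ≤ 1) :
    ∑ x : ι → X, ∑ y : ι → Y, (∏ i, G.T (x i) (y i)) *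
      Real.exp (∑ i, l * G.queryDev S (x i) (y i)) ≤ Real.exp (l ^ 2 / 4) ^ Fintype.card ι := by
  have h1 : ∑ x, ∑ y, G.T x y * Real.exp (l * G.queryDev S x y) ≤ Real.exp (l ^ 2 / 4) := by
    have := sum_mul_exp_le (κ := X × Y) (w := fun z => G.T z.1 z.2) (f := finsetInd S)
      (m := ∑ x', ∑ y', G.T x' y' * finsetInd S (x', y')) (l := l) (fun z => G.T_nonneg _ _)
      (finsetInd_eq S)
      (Finset.sum_nonneg fun x _ => Finset.sum_nonneg fun y _ =>
        mul_nonneg (G.T_nonneg x y) (finsetInd_nonneg S _))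
      (G.T_sum ▸ Finset.sum_le_sum fun x _ => Finset.sum_le_sum fun y _ =>
        mul_le_of_le_one_right (G.T_nonneg x y) (finsetInd_le_one S _))
      (by simp only [Fintype.sum_prod_type, G.T_sum, mul_one]) hl0 hl1
    simpa only [Fintype.sum_prod_type, G.T_sum, mul_one, queryDev] using this
  calc _ = ∏ _i : ι, ∑ x, ∑ y, G.T x y * Real.exp (l * G.queryDev S x y) := by
        rw [Fintype.prod_sum]
        refine Finset.sum_congr rfl fun x _ => ?_
        rw [Fintype.prod_sum]
        exact Finset.sum_congr rfl fun y _ => by rw [Finset.prod_mul_distrib, Real.exp_sum]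
    _ ≤ _ := by
        rw [Finset.prod_const, Finset.card_univ]
        exact pow_le_pow_left₀ (Finset.sum_nonneg fun x _ => Finset.sum_nonneg fun y _ =>
          mul_nonneg (G.T_nonneg x y) (Real.exp_pos _).le) h1 _

/-- The number of rounds that are won. -/
noncomputable def wins (G : TwoPlayerGame X Y A B) (x : ι → X) (y : ι → Y) (a : ι → A)
    (b : ι → B) : ℝ :=
  ∑ i, if G.V (a i) (b i) (x i) (y i) = true then (1 : ℝ) else 0

theorem exists_deviation [Fintype A] [Fintype B] [Nonempty A] [Nonempty B] [Nonempty ι] (G : TwoPlayerGame X Y A B)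
    {δ α : ℝ} (hG : G.nsValue ≤ 1 - δ) {x : ι → X} {y : ι → Y} {a : ι → A} {b : ι → B}
    (hwin : (1 - δ + α) * Fintype.card ι ≤ G.wins x y a b) :
    (∃ S, α / 4 * Fintype.card ι ≤ ∑ i, condDev G.T S (x i) (y i) (a i)) ∨
    (∃ S, α / 4 * Fintype.card ι ≤ ∑ i, condDev (fun y x => G.T x y) S (y i) (x i) (b i)) ∨
    ∃ S, α / 4 * Fintype.card ι ≤ ∑ i, G.queryDev S (x i) (y i) := by
  classical
  have hN : (0 : ℝ) < Fintype.card ι := Nat.cast_pos.2 Fintype.card_pos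
  set Q := empirical x y a b with hQ
  have hQ0 : ∀ x' y' a' b', 0 ≤ Q x' y' a' b' := empirical_nonneg x y a b
  have hQ1 : ∑ x, ∑ y, ∑ a, ∑ b, Q x y a b = 1 := by
    have := sum_mul_empirical x y a b fun _ _ _ _ => 1
    simpa [hN.ne'] using this
  have hQV : 1 - δ + α ≤
      ∑ x, ∑ y, ∑ a, ∑ b, (if G.V a b x y = true then 1 else 0) * Q x y a b := by
    rw [sum_mul_empirical x y a b fun x y a b => if G.V a b x y = true then 1 else 0,
      le_div_iff₀ hN]
    exact hwin
  obtain ⟨S₁, h₁⟩ := exists_condDev G.T fun x y a => ∑ b, Q x y a b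
  obtain ⟨S₂, h₂⟩ := exists_condDev (fun y x => G.T x y) fun y x b => ∑ a, Q x y a b
  obtain ⟨S₃, h₃⟩ := G.exists_queryDev hQ1
  have e₁ := sum_excess_le G.T_nonneg (q := fun x y a => ∑ b, Q x y a b)
    fun x y a => Finset.sum_nonneg fun b _ => hQ0 x y a b
  have e₂ := sum_excess_le (fun y x => G.T_nonneg x y) (q := fun y x b => ∑ a, Q x y a b)
    fun y x b => Finset.sum_nonneg fun a _ => hQ0 x y a b
  have e := G.sum_win_le hQ0
  have e₃ : ∑ y, ∑ x, max (∑ b, ∑ a, Q x y a b - G.T x y) 0 =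
      ∑ x, ∑ y, max (∑ a, ∑ b, Q x y a b - G.T x y) 0 := by
    rw [Finset.sum_comm]
    exact Finset.sum_congr rfl fun x _ => Finset.sum_congr rfl fun y _ => by
      rw [Finset.sum_comm (f := fun b a => Q x y a b)]
  rw [Finset.sum_comm] at e₂
  rw [h₁, h₃] at e₁
  rw [h₂, e₃, h₃] at e₂
  have f₁ := sum_mul_empirical x y a b fun x y a _ => condDev G.T S₁ x y a
  have f₂ := sum_mul_empirical x y a b fun x y _ b => condDev (fun y x => G.T x y) S₂ y x b
  have f₃ := sum_mul_empirical x y a b fun x y _ _ => G.queryDev S₃ x y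
  rw [← hQ] at f₁ f₂ f₃
  simp only [← Finset.mul_sum] at f₁ f₃
  have f₂' : ∑ y, ∑ x, ∑ b, condDev (fun y x => G.T x y) S₂ y x b * ∑ a, Q x y a b =
      (∑ i, condDev (fun y x => G.T x y) S₂ (y i) (x i) (b i)) / Fintype.card ι := by
    rw [← f₂, Finset.sum_comm]
    refine Finset.sum_congr rfl fun x _ => Finset.sum_congr rfl fun y _ => ?_
    rw [Finset.sum_comm (s := (Finset.univ : Finset A))]
    simp only [Finset.mul_sum]
  rw [f₁, f₃] at e₁
  rw [f₂', f₃] at e₂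
  simp only [← le_div_iff₀ hN]
  by_contra! hcon
  have c₁ := hcon.1 S₁
  have c₂ := hcon.2.1 S₂
  have c₃ := hcon.2.2 S₃
  linarith

end TwoPlayerGame

theorem one_le_sum_exp {κ : Type*} [Fintype κ] {f : κ → ℝ} {k : κ} (hk : 0 ≤ f k) :
    1 ≤ ∑ k, Real.exp (f k) :=
  (Real.one_le_exp hk).trans
    (Finset.single_le_sum (f := fun k => Real.exp (f k)) (fun _ _ => (Real.exp_pos _).le)
      (Finset.mem_univ k))

theorem sum_comm_four {κ I J K L : Type*} [Fintype κ] [Fintype I] [Fintype J] [Fintype K]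
    [Fintype L] (f : κ → I → J → K → L → ℝ) :
    ∑ s, ∑ i, ∑ j, ∑ k, ∑ l, f s i j k l = ∑ i, ∑ j, ∑ k, ∑ l, ∑ s, f s i j k l := by
  simp_rw [Finset.sum_comm (s := (Finset.univ : Finset κ))]

/-- A sum over functions on a product, of products over the first factor. -/
theorem sum_prod_curry {κ ι A : Type*} [Fintype κ] [Fintype ι] [Fintype A] [DecidableEq κ]
    [DecidableEq ι] (f : κ → (ι → A) → ℝ) :
    ∑ a : κ × ι → A, ∏ j, f j (fun i => a (j, i)) = ∏ j, ∑ a : ι → A, f j a := by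
  rw [Fintype.prod_sum]
  exact (Equiv.curry κ ι A).sum_comp fun a : κ → ι → A => ∏ j, f j (a j)

namespace TwoPlayerGame

variable {X Y A B ι : Type*} [Fintype A] [Fintype B] [Fintype ι] [DecidableEq ι]

/-- The correlation of several groups of rounds that are played independently with `P`. -/
def blockCorrelation (κ : Type*) [Fintype κ] (P : (ι → A) → (ι → B) → (ι → X) → (ι → Y) → ℝ)
    (a : κ × ι → A) (b : κ × ι → B) (x : κ × ι → X) (y : κ × ι → Y) : ℝ :=
  ∏ j, P (fun i => a (j, i)) (fun i => b (j, i)) (fun i => x (j, i)) (fun i => y (j, i))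

theorem isNoSignalling_blockCorrelation (κ : Type*) [Fintype κ] [DecidableEq κ]
    {P : (ι → A) → (ι → B) → (ι → X) → (ι → Y) → ℝ} (hP : IsNoSignalling P) :
    IsNoSignalling (blockCorrelation κ P) := by
  have hb : ∀ x y a, ∑ b, blockCorrelation κ P a b x y =
      ∏ j, ∑ b, P (fun i => a (j, i)) b (fun i => x (j, i)) (fun i => y (j, i)) := fun x y a =>
    sum_prod_curry fun j b => P (fun i => a (j, i)) b (fun i => x (j, i)) (fun i => y (j, i))
  have ha : ∀ x y b, ∑ a, blockCorrelation κ P a b x y =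
      ∏ j, ∑ a, P a (fun i => b (j, i)) (fun i => x (j, i)) (fun i => y (j, i)) := fun x y b =>
    sum_prod_curry fun j a => P a (fun i => b (j, i)) (fun i => x (j, i)) (fun i => y (j, i))
  obtain ⟨p, hp, hpP⟩ := hP.fst
  obtain ⟨q, hq, hqP⟩ := hP.snd
  have hpc : IsCondProb fun (a : κ × ι → A) (x : κ × ι → X) =>
      ∏ j, p (fun i => a (j, i)) (fun i => x (j, i)) := fun x =>
    ⟨fun a => Finset.prod_nonneg fun j _ => (hp _).1 _, by
      rw [sum_prod_curry fun j a => p a (fun i => x (j, i))]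
      simp [(hp _).2]⟩
  have hqc : IsCondProb fun (b : κ × ι → B) (y : κ × ι → Y) =>
      ∏ j, q (fun i => b (j, i)) (fun i => y (j, i)) := fun y =>
    ⟨fun b => Finset.prod_nonneg fun j _ => (hq _).1 _, by
      rw [sum_prod_curry fun j b => q b (fun i => y (j, i))]
      simp [(hq _).2]⟩
  refine ⟨fun a b x y => Finset.prod_nonneg fun j _ => hP.nonneg _ _ _ _, fun x y => ?_,
    ⟨_, hpc, fun x y a => ?_⟩, ⟨_, hqc, fun x y b => ?_⟩⟩
  · simp only [hb, hpP, (hpc x).2]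
  · simp only [hb, hpP]
  · simp only [ha, hqP]

variable [Fintype X] [Fintype Y]

/-- The probability that at least `t` of the rounds indexed by `ι` are won with the
correlation `P`. -/
noncomputable def tailProb (G : TwoPlayerGame X Y A B) (t : ℝ)
    (P : (ι → A) → (ι → B) → (ι → X) → (ι → Y) → ℝ) : ℝ :=
  ∑ x, ∑ y, ∑ a, ∑ b, (∏ i, G.T (x i) (y i)) * (if t ≤ G.wins x y a b then 1 else 0) * P a b x y

/-- The number of sets in the union bound for the tail probability. -/
noncomputable def unionCard (_G : TwoPlayerGame X Y A B) : ℝ :=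
  Fintype.card (Finset (X × Y × A)) + Fintype.card (Finset (Y × X × B)) +
    Fintype.card (Finset (X × Y))

theorem sum_fst_exp_le (G : TwoPlayerGame X Y A B) {l : ℝ} (hl0 : 0 ≤ l) (hl1 : l ≤ 1)
    {P : (ι → A) → (ι → B) → (ι → X) → (ι → Y) → ℝ} (hP : IsNoSignalling P)
    (S : Finset (X × Y × A)) :
    ∑ x, ∑ y, ∑ a, ∑ b, (∏ i, G.T (x i) (y i)) * P a b x y *
      Real.exp (∑ i, l * condDev G.T S (x i) (y i) (a i)) ≤
        Real.exp (l ^ 2 / 4) ^ Fintype.card ι := by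
  obtain ⟨p, hp, hpP⟩ := hP.fst
  refine le_of_eq_of_le ?_ (sum_prod_mul_exp_le G.T_nonneg G.T_sum hp
    fun x a => sum_mul_exp_condDev_le G.T_nonneg S hl0 hl1 x a)
  refine Finset.sum_congr rfl fun x _ => Finset.sum_congr rfl fun y _ =>
    Finset.sum_congr rfl fun a _ => ?_
  rw [← Finset.sum_mul, ← Finset.mul_sum, hpP]

/-- The game with the roles of the players exchanged. -/
def swap (G : TwoPlayerGame X Y A B) : TwoPlayerGame Y X B A where
  T y x := G.T x y
  V b a y x := G.V a b x y
  T_nonneg y x := G.T_nonneg x y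
  T_sum := by rw [Finset.sum_comm]; exact G.T_sum

theorem tailProb_le [Nonempty A] [Nonempty B] [Nonempty ι] (G : TwoPlayerGame X Y A B) {δ α : ℝ}
    (hG : G.nsValue ≤ 1 - δ) (hα0 : 0 < α) (hα1 : α ≤ 1)
    {P : (ι → A) → (ι → B) → (ι → X) → (ι → Y) → ℝ} (hP : IsNoSignalling P) {t : ℝ}
    (ht : (1 - δ + α) * Fintype.card ι ≤ t) :
    G.tailProb t P ≤ G.unionCard * Real.exp (-(α ^ 2 / 16)) ^ Fintype.card ι := by
  set N : ℝ := ((Fintype.card ι : ℕ) : ℝ) with hN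
  set l : ℝ := α / 2 with hl
  have hl0 : 0 ≤ l := by positivity
  have hl1 : l ≤ 1 := by linarith
  set c : ℝ := -(l * (α / 4 * N)) with hc
  set D : (ι → X) → (ι → Y) → ℝ := fun x y => ∏ i, G.T (x i) (y i) with hD
  have hD0 : ∀ x y, 0 ≤ D x y := fun x y => Finset.prod_nonneg fun i _ => G.T_nonneg _ _
  set E₁ : Finset (X × Y × A) → (ι → X) → (ι → Y) → (ι → A) → ℝ := fun S x y a =>
    Real.exp (∑ i, l * condDev G.T S (x i) (y i) (a i)) with hE₁
  set E₂ : Finset (Y × X × B) → (ι → X) → (ι → Y) → (ι → B) → ℝ := fun S x y b =>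
    Real.exp (∑ i, l * condDev (fun y x => G.T x y) S (y i) (x i) (b i)) with hE₂
  set E₃ : Finset (X × Y) → (ι → X) → (ι → Y) → ℝ := fun S x y =>
    Real.exp (∑ i, l * G.queryDev S (x i) (y i)) with hE₃
  have markov : ∀ x y a b, (if t ≤ G.wins x y a b then (1 : ℝ) else 0) ≤
      Real.exp c * (∑ S, E₁ S x y a + ∑ S, E₂ S x y b + ∑ S, E₃ S x y) := by
    intro x y a b
    have p₁ : 0 ≤ ∑ S, E₁ S x y a := Finset.sum_nonneg fun S _ => (Real.exp_pos _).le
    have p₂ : 0 ≤ ∑ S, E₂ S x y b := Finset.sum_nonneg fun S _ => (Real.exp_pos _).le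
    have p₃ : 0 ≤ ∑ S, E₃ S x y := Finset.sum_nonneg fun S _ => (Real.exp_pos _).le
    split_ifs with h
    · have aux : ∀ {s : ℝ}, α / 4 * N ≤ s → 0 ≤ c + l * s := fun {s} hs => by
        have := mul_le_mul_of_nonneg_left hs hl0
        linarith
      rw [mul_add, mul_add]
      have q₁ := mul_nonneg (Real.exp_pos c).le p₁
      have q₂ := mul_nonneg (Real.exp_pos c).le p₂
      have q₃ := mul_nonneg (Real.exp_pos c).le p₃
      rcases G.exists_deviation hG (ht.trans h) with ⟨S, hS⟩ | ⟨S, hS⟩ | ⟨S, hS⟩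
      · have : 1 ≤ Real.exp c * ∑ S, E₁ S x y a := by
          simp only [hE₁, Finset.mul_sum, ← Real.exp_add]
          simp only [← Finset.mul_sum]
          exact one_le_sum_exp (aux hS)
        linarith
      · have : 1 ≤ Real.exp c * ∑ S, E₂ S x y b := by
          simp only [hE₂, Finset.mul_sum, ← Real.exp_add]
          simp only [← Finset.mul_sum]
          exact one_le_sum_exp (aux hS)
        linarith
      · have : 1 ≤ Real.exp c * ∑ S, E₃ S x y := by
          simp only [hE₃, Finset.mul_sum, ← Real.exp_add]
          simp only [← Finset.mul_sum]
          exact one_le_sum_exp (aux hS)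
        linarith
    · exact mul_nonneg (Real.exp_pos _).le (by positivity)
  have b₁ : ∀ S, ∑ x, ∑ y, ∑ a, ∑ b, D x y * P a b x y * E₁ S x y a ≤
      Real.exp (l ^ 2 / 4) ^ Fintype.card ι := fun S => G.sum_fst_exp_le hl0 hl1 hP S
  have b₂ : ∀ S, ∑ x, ∑ y, ∑ a, ∑ b, D x y * P a b x y * E₂ S x y b ≤
      Real.exp (l ^ 2 / 4) ^ Fintype.card ι := fun S => by
    refine le_of_eq_of_le ?_ (G.swap.sum_fst_exp_le hl0 hl1 hP.swap S)
    rw [Finset.sum_comm]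
    exact Finset.sum_congr rfl fun y _ => Finset.sum_congr rfl fun x _ => Finset.sum_comm
  have b₃ : ∀ S, ∑ x, ∑ y, ∑ a, ∑ b, D x y * P a b x y * E₃ S x y ≤
      Real.exp (l ^ 2 / 4) ^ Fintype.card ι := fun S => by
    simp only [← Finset.sum_mul, ← Finset.mul_sum, hP.normalized, mul_one]
    exact G.sum_prod_mul_exp_queryDev_le S hl0 hl1
  calc G.tailProb t P ≤ ∑ x, ∑ y, ∑ a, ∑ b, Real.exp c * (∑ S, D x y * P a b x y * E₁ S x y a +
        ∑ S, D x y * P a b x y * E₂ S x y b + ∑ S, D x y * P a b x y * E₃ S x y) := by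
        refine Finset.sum_le_sum fun x _ => Finset.sum_le_sum fun y _ => Finset.sum_le_sum fun a _ =>
          Finset.sum_le_sum fun b _ => ?_
        have := mul_le_mul_of_nonneg_left (markov x y a b)
          (mul_nonneg (hD0 x y) (hP.nonneg a b x y))
        simp only [← Finset.mul_sum]
        linarith
    _ = Real.exp c * (∑ S, ∑ x, ∑ y, ∑ a, ∑ b, D x y * P a b x y * E₁ S x y a +
        ∑ S, ∑ x, ∑ y, ∑ a, ∑ b, D x y * P a b x y * E₂ S x y b +
        ∑ S, ∑ x, ∑ y, ∑ a, ∑ b, D x y * P a b x y * E₃ S x y) := by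
        rw [sum_comm_four fun S x y a b => D x y * P a b x y * E₁ S x y a,
          sum_comm_four fun S x y a b => D x y * P a b x y * E₂ S x y b,
          sum_comm_four fun S x y a b => D x y * P a b x y * E₃ S x y]
        simp only [Finset.sum_add_distrib, ← Finset.mul_sum]
    _ ≤ Real.exp c * (∑ _S : Finset (X × Y × A), Real.exp (l ^ 2 / 4) ^ Fintype.card ι +
        ∑ _S : Finset (Y × X × B), Real.exp (l ^ 2 / 4) ^ Fintype.card ι +
        ∑ _S : Finset (X × Y), Real.exp (l ^ 2 / 4) ^ Fintype.card ι) := by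
        gcongr with S _ S _ S _
        · exact b₁ S
        · exact b₂ S
        · exact b₃ S
    _ = G.unionCard * (Real.exp c * Real.exp (l ^ 2 / 4) ^ Fintype.card ι) := by
        simp only [Finset.sum_const, Finset.card_univ, nsmul_eq_mul, unionCard]
        ring
    _ = _ := by
        rw [← Real.exp_nat_mul, ← Real.exp_nat_mul, ← Real.exp_add]
        congr 2
        rw [hc, hl]
        ring

theorem tailProb_pow_le (κ : Type*) [Fintype κ] [DecidableEq κ] (G : TwoPlayerGame X Y A B) (t : ℝ)
    {P : (ι → A) → (ι → B) → (ι → X) → (ι → Y) → ℝ} (hP : IsNoSignalling P) :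
    G.tailProb t P ^ Fintype.card κ ≤
      G.tailProb (Fintype.card κ * t) (blockCorrelation κ P) := by
  set F : (ι → X) → (ι → Y) → (ι → A) → (ι → B) → ℝ := fun x y a b =>
    (∏ i, G.T (x i) (y i)) * (if t ≤ G.wins x y a b then 1 else 0) * P a b x y with hF
  have expand : G.tailProb t P ^ Fintype.card κ =
      ∑ x : κ × ι → X, ∑ y : κ × ι → Y, ∑ a : κ × ι → A, ∑ b : κ × ι → B,
        ∏ j, F (fun i => x (j, i)) (fun i => y (j, i)) (fun i => a (j, i)) (fun i => b (j, i)) := by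
    rw [← Finset.card_univ, ← Finset.prod_const]
    refine (sum_prod_curry fun (_ : κ) x => ∑ y, ∑ a, ∑ b, F x y a b).symm.trans ?_
    refine Finset.sum_congr rfl fun x _ => ?_
    refine (sum_prod_curry fun j y => ∑ a, ∑ b, F (fun i => x (j, i)) y a b).symm.trans ?_
    refine Finset.sum_congr rfl fun y _ => ?_
    refine (sum_prod_curry fun j a =>
      ∑ b, F (fun i => x (j, i)) (fun i => y (j, i)) a b).symm.trans ?_
    refine Finset.sum_congr rfl fun a _ => ?_
    exact (sum_prod_curry fun j b =>
      F (fun i => x (j, i)) (fun i => y (j, i)) (fun i => a (j, i)) b).symm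
  rw [expand]
  refine Finset.sum_le_sum fun x _ => Finset.sum_le_sum fun y _ => Finset.sum_le_sum fun a _ =>
    Finset.sum_le_sum fun b _ => ?_
  simp only [hF, Finset.prod_mul_distrib, blockCorrelation, Fintype.prod_prod_type]
  refine mul_le_mul_of_nonneg_right (mul_le_mul_of_nonneg_left ?_ ?_) ?_
  · rw [Finset.prod_ite_zero]
    by_cases h : ∀ j ∈ (Finset.univ : Finset κ),
      t ≤ G.wins (fun i => x (j, i)) (fun i => y (j, i)) (fun i => a (j, i)) (fun i => b (j, i))
    · have : Fintype.card κ * t ≤ G.wins x y a b := by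
        have := Finset.card_nsmul_le_sum _ _ _ h
        rw [Finset.card_univ, nsmul_eq_mul] at this
        refine this.trans_eq ?_
        simp only [wins, Fintype.sum_prod_type]
      rw [if_pos h, if_pos this, Finset.prod_const_one]
    · rw [if_neg h]
      split_ifs <;> simp
  · exact Finset.prod_nonneg fun j _ => Finset.prod_nonneg fun i _ => G.T_nonneg _ _
  · exact Finset.prod_nonneg fun j _ => hP.nonneg _ _ _ _

theorem le_of_forall_pow_le_mul_pow {u v K : ℝ} (hv : 0 < v)
    (h : ∀ m : ℕ, u ^ m ≤ K * v ^ m) : u ≤ v := by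
  by_contra! hlt
  obtain ⟨m, hm⟩ := pow_unbounded_of_one_lt K ((one_lt_div hv).2 hlt)
  rw [div_pow, lt_div_iff₀ (pow_pos hv m)] at hm
  exact absurd (h m) (not_le.2 hm)

theorem nsValue_threshold_le [Nonempty A] [Nonempty B] (G : TwoPlayerGame X Y A B) {δ α : ℝ}
    (hG : G.nsValue ≤ 1 - δ) (hα0 : 0 < α) (hα1 : α ≤ 1) (n : ℕ) {t : ℝ}
    (ht : (1 - δ + α) * n ≤ t) :
    (G.threshold n t).nsValue ≤ Real.exp (-(α ^ 2 / 16)) ^ n := by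
  refine Real.sSup_le ?_ (by positivity)
  rintro _ ⟨P, hP, rfl⟩
  rcases n.eq_zero_or_pos with rfl | hn
  · simpa using winProb_le_one _ hP
  have hw : (G.threshold n t).winProb P = G.tailProb t P := by
    simp [winProb, tailProb, threshold, wins]
  rw [hw]
  have : Nonempty (Fin n) := ⟨⟨0, hn⟩⟩
  refine le_of_forall_pow_le_mul_pow (K := max 1 G.unionCard) (by positivity) fun m => ?_
  rcases m.eq_zero_or_pos with rfl | hm
  · simp
  have : Nonempty (Fin m) := ⟨⟨0, hm⟩⟩
  have h1 := G.tailProb_pow_le (Fin m) t hP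
  have h2 := G.tailProb_le hG hα0 hα1 (isNoSignalling_blockCorrelation (Fin m) hP)
    (t := Fintype.card (Fin m) * t) (by
      have := mul_le_mul_of_nonneg_left ht m.cast_nonneg
      simp only [Fintype.card_prod, Fintype.card_fin, Nat.cast_mul]
      linarith)
  have h3 := h1.trans h2
  simp only [Fintype.card_prod, Fintype.card_fin] at h3
  rw [mul_comm m n, pow_mul] at h3
  refine h3.trans ?_
  gcongr
  exact le_max_right _ _

theorem nsValue_rep_eq (G : TwoPlayerGame X Y A B) (n : ℕ) :
    (G.rep n).nsValue = (G.threshold n n).nsValue := by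
  have : G.rep n = G.threshold n n := by
    simp only [rep, threshold, TwoPlayerGame.mk.injEq, true_and]
    funext a b x y
    rw [decide_eq_decide]
    constructor
    · intro h
      simp [h]
    · intro h i
      by_contra hi
      refine absurd h (not_le.2 ?_)
      calc _ < ∑ _i : Fin n, (1 : ℝ) := by
            refine Finset.sum_lt_sum (fun j _ => by split_ifs <;> simp) ⟨i, Finset.mem_univ i, ?_⟩
            simp [hi]
        _ = n := by simp
  rw [this]

end TwoPlayerGame

theorem theorem3 {X Y A B : Type*} [Fintype X] [Fintype Y] [Fintype A] [Fintype B]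
    [Nonempty A] [Nonempty B] (G : TwoPlayerGame X Y A B) (δ : ℝ) (hδ₀ : 0 < δ) (hδ₁ : δ < 1)
    (hG : G.nsValue ≤ 1 - δ) :
    (∀ n : ℕ, (G.rep n).nsValue ≤ (1 - δ ^ 2 / 27) ^ n) ∧
    (∀ (n : ℕ) (α t : ℝ), 0 < α → α ≤ δ → (1 - δ + α) * n ≤ t →
      (G.threshold n t).nsValue ≤ Real.exp (-n * (α ^ 2 / 33))) := by
  refine ⟨fun n => ?_, fun n α t hα₀ hα ht => ?_⟩
  · rw [G.nsValue_rep_eq]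
    refine (G.nsValue_threshold_le hG hδ₀ hδ₁.le n (by simp)).trans ?_
    refine pow_le_pow_left₀ (Real.exp_pos _).le ?_ n
    have h0 : 0 ≤ δ ^ 2 / 16 := by positivity
    have h1 : δ ^ 2 / 16 ≤ 1 / 16 := by nlinarith
    have h2 := (abs_le.1 (Real.abs_exp_sub_one_sub_id_le
      (x := -(δ ^ 2 / 16)) (by rw [abs_neg, abs_of_nonneg h0]; linarith))).2
    nlinarith [mul_nonneg h0 (sub_nonneg.2 h1)]
  · refine (G.nsValue_threshold_le hG hα₀ (hα.trans hδ₁.le) n ht).trans ?_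
    rw [← Real.exp_nat_mul]
    refine Real.exp_le_exp.2 ?_
    have : 0 ≤ (n : ℝ) * α ^ 2 := by positivity
    linarith
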